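/- **Local super spectral curves.** A local super spectral curve (with one component) is given by parameters $\tau_l\in\mathbb C$ ($l\ge1$) with $|\tau_1|+|\tau_3|>0$, $\phi_{kl}=\phi_{lk}\in\mathbb C$ ($k,l\ge1$), and $\psi_{kl}\in\mathbb C$ ($k,l\ge0$) with $\psi_{00}=0$ and $\psi_{kl}+\psi_{lk}+\psi_{0k}\psi_{0l}=0$. Let $\Theta_z$ be a formal symbol with $\Theta_z^2=z\,dz$, and let $\sigma:z\mapsto-z$, with $\sigma(dz)=-dz$ and $\sigma(\Theta_z)=\Theta_z$. Put $$d\xi_{-l}=\Big(z^{-l-1}+\sum_{m\ge1}\tfrac{\phi_{lm}}{l}z^{m-1}\Big)dz\ (l\ge1),\qquad \eta_{-l}=\Big(z^{-l-1}+\sum_{k\ge0}\psi_{lk}z^{k-1}\Big)\Theta_z\ (l\ge0),$$ let $V^{B-}$ and $V^{F0,-}$ be the spans of the $d\xi_{-l}$ and of the $\eta_{-l}$, and let $$\omega_{0,1|0}(z|)=\sum_{l\ge1}\tau_lz^{l-1}dz,\qquad \omega_{0,2|0}(z_1,z_2|)=\frac{dz_1dz_2}{(z_1-z_2)^2}+\sum_{k,l\ge1}\phi_{kl}z_1^{k-1}z_2^{l-1}dz_1dz_2,$$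 $$\omega_{0,0|2}(|z_1,z_2)=-\frac12\,\frac{z_1+z_2}{z_1-z_2}\,\frac{\Theta_1\Theta_2}{z_1z_2}-\sum_{k,l\ge1}\frac{\psi_{k-1,l-1}-\psi_{l-1,k-1}}{1+\delta_{(k-1)(l-1),0}}\,\frac{z_1^{l-1}z_2^{k-1}\Theta_1\Theta_2}{2z_1z_2}.$$ **Super topological recursion.** The correlators $\omega_{g,n|2m}\in(V^{B-})^{\otimes n}\otimes(V^{F0,-})^{\otimes 2m}$, $2g+n+2m>2$, $(n,m)\ne(0,0)$, are computed recursively in $2g+n+2m$ by $$\omega_{g,n+1|2m}(z_0,J|K)=\mathop{\rm Res}_{z\to0}K^{BB}(z_0,z)\big(\tilde Q^{BB}_{g,n+1|2m}(z,J|K)+\tilde Q^{FF}_{g,n+1|2m}(z,J|K)\big),\tag{B}$$ $$\omega_{g,n|2m+2}(J|u_1,u_2,K)=\hat\omega(J|u_1,u_2,K)-\eta_0(u_1)\mathop{\rm Res}_{z\to0}\hat\omega(J|u_2,z,K)\,\eta_0(z),\tag{F}$$ $$\hat\omega(J|u_1,u_2,K)=\mathop{\rm Res}_{z\to0}K^{BF}(u_1,z)\,\tilde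 Q^{FB}_{g,n|2m+2}(J|z,u_2,K),$$ where the series are expanded for $z$ near $0$, and where $$K^{BB}(z_0,z)=\frac{\int_0^z\omega_{0,2|0}(z_0,\cdot|)}{\omega_{0,1|0}(z|)-\omega_{0,1|0}(\sigma(z)|)},\qquad K^{BF}(z_0,z)=\frac{\omega_{0,0|2}(|z,z_0)-\frac12\eta_0(z)\eta_0(z_0)}{\omega_{0,1|0}(z|)-\omega_{0,1|0}(\sigma(z)|)}.$$ Let $\sum$ denote the sum over $g_1+g_2=g$, $J_1\sqcup J_2=J$, $K_1\sqcup K_2=K$, let $(-1)^\rho$ be the sign of the permutation taking $K$ to $(K_1,K_2)$, let $\mathcal D_z(f\Theta_z)=df\,\Theta_z$, let terms with negative genus or with an odd number of fermionic entries be $0$, and let the tilde mean that all terms containing $\omega_{0,1|0}$ are omitted. Then $$Q^{FB}_{g}(J|z,K)=\omega_{g-1}(z,J|\sigma(z),K)+\omega_{g-1}(\sigma(z),J|z,K)+\sum(-1)^\rho\big(\omega_{g_1}(z,J_1|K_1)\,\omega_{g_2}(J_2|\sigma(z),K_2)+\omega_{g_1}(\sigma(z),J_1|K_1)\,\omega_{g_2}(J_2|z,K_2)\big),$$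 $$Q^{BB}_{g}(z,J|K)=\omega_{g-1}(z,\sigma(z),J|K)+\sum(-1)^\rho\,\omega_{g_1}(z,J_1|K_1)\,\omega_{g_2}(\sigma(z),J_2|K_2),$$ $$Q^{FF}_{g}(z,J|K)=-\tfrac12\big(\mathcal D_z\omega_{g-1}(J|z,u,K)+\mathcal D_u\omega_{g-1}(J|u,z,K)\big)\big|_{u=\sigma(z)}+\tfrac12\sum(-1)^\rho\big(\mathcal D_z\omega_{g_1}(J_1|z,K_1)\,\omega_{g_2}(J_2|\sigma(z),K_2)+\mathcal D_z\omega_{g_1}(J_1|\sigma(z),K_1)\,\omega_{g_2}(J_2|z,K_2)\big).$$ **Proposition.** For every local super spectral curve and every $m\ge2$, $$\omega_{0,0|2m}=0\qquad\text{and}\qquad\omega_{0,1|2m}=0.$$ This holds for the correlators constructed by using (B) for all $n\ge1$ and (F) for $n=0$, and for every system of differentials with an even number of fermionic entries that satisfies both (B) and (F) whenever they apply. -/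

import Mathlib

namespace SuperTR

noncomputable section

/-! ### Formal Laurent series in one and two variables -/

/-- The local coordinate `z`. -/
def zz : LaurentSeries ℂ := HahnSeries.single 1 1

/-- The residue at `z = 0` of `f(z) dz`. -/
def res (f : LaurentSeries ℂ) : ℂ := f.coeff (-1)

/-- Substitution `f(z) ↦ f(-z)`. -/
def reflect (f : LaurentSeries ℂ) : LaurentSeries ℂ where
  coeff n := (-1 : ℂ) ^ n * f.coeff n
  isPWO_support' := f.isPWO_support.mono fun n hn => by
    intro h
    exact hn (by simp [h])

/-- The involution on one-forms: `f(z) dz ↦ f(-z) d(-z) = -f(-z) dz`. -/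
def sigmaB (f : LaurentSeries ℂ) : LaurentSeries ℂ := -reflect f

/-- The involution on fermionic differentials: `f(z) Θ ↦ f(-z) Θ`, as `Θ` is invariant. -/
def sigmaF (f : LaurentSeries ℂ) : LaurentSeries ℂ := reflect f

/-- The differential `f ↦ df = f'(z) dz`, which is the operator `𝓓 (f Θ) = df Θ` on fermionic
differentials. -/
def dd (f : LaurentSeries ℂ) : LaurentSeries ℂ := LaurentSeries.derivative ℂ f

/-- The fermionic pairing `Res f Θ · g Θ = Res f g z dz`, as `Θ² = z dz`. -/
def OmegaF (f g : LaurentSeries ℂ) : ℂ := res (f * g * zz)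

/-- Series in two variables `(z, w)` expanded in the domain `|z| < |w|`: the field `ℂ((w))((z))`.
Rational functions of `z, w` computed in this field are automatically expanded there. -/
abbrev TwoVar : Type := LaurentSeries (LaurentSeries ℂ)

/-- The variable `z` (the small one) of `ℂ((w))((z))`. -/
def varZ : TwoVar := HahnSeries.single 1 1

/-- The variable `w` (the large one) of `ℂ((w))((z))`. -/
def varW : TwoVar := HahnSeries.C zz

/-- A series `f` in the variable `z`. -/
def inZ (f : LaurentSeries ℂ) : TwoVar := f.map (HahnSeries.C : ℂ →+* LaurentSeries ℂ)

/-- A series `f` in the variable `w`. -/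
def inW (f : LaurentSeries ℂ) : TwoVar := HahnSeries.C f

/-- The power series `∑_{a,b ≥ 0} c a b z^a w^b`. -/
def doubleSeries (c : ℕ → ℕ → ℂ) : TwoVar :=
  HahnSeries.ofPowerSeries ℤ (LaurentSeries ℂ)
    (PowerSeries.mk fun a => HahnSeries.ofPowerSeries ℤ ℂ (PowerSeries.mk fun b => c a b))

/-- The primitive `∫₀ᶻ f dz` in the variable `z` (used for `f` without poles in `z`). -/
def integrateZ (f : TwoVar) : TwoVar :=
  varZ * { coeff := fun n => HahnSeries.C ((n : ℂ) + 1)⁻¹ * f.coeff n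
           isPWO_support' := f.isPWO_support.mono fun n hn => by
            intro h
            exact hn (by simp [h]) }

/-- Apply an additive functional in the variable `w` to a series in `(z, w)`. -/
def applyW (φ : LaurentSeries ℂ →+ ℂ) (f : TwoVar) : LaurentSeries ℂ := f.map φ

/-! ### Local super spectral curves -/

/-- A local super spectral curve (with one component): dilaton shift parameters `τ_l`, `l ≥ 1`, with
`|τ₁| + |τ₃| > 0`, bosonic polarization parameters `φ_{kl} = φ_{lk}`, `k, l ≥ 1`, and fermionic
polarization parameters `ψ_{kl}`, `k, l ≥ 0`. -/
structure LocalSuperSpectralCurve where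
  τ : ℕ+ → ℂ
  φ : ℕ+ → ℕ+ → ℂ
  ψ : ℕ → ℕ → ℂ
  admissible : 0 < ‖τ 1‖ + ‖τ 3‖
  φ_symm : ∀ k l, φ k l = φ l k
  ψ_zero : ψ 0 0 = 0
  ψ_rel : ∀ k l, ψ k l + ψ l k + ψ 0 k * ψ 0 l = 0

/-- A system of multilinear differentials `ω_{g,n|k}` respecting the polarization, that is, with values
in `(V^{B-})^{⊗ n} ⊗ (V^{F0,-})^{⊗ k}`, given by its coefficients: for `J = [i₁,…,iₙ]` and
`K = [j₁,…,j_k]`, the number `ω g J K` is the coefficient of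
`dξ_{-i₁} ⊗ ⋯ ⊗ dξ_{-iₙ} ⊗ η_{-j₁} ⊗ ⋯ ⊗ η_{-j_k}` in `ω_{g,n|k}`. -/
abbrev System : Type := ℕ → List ℕ+ → List ℕ → ℂ

/-- `ω_{g,n|k} = 0`. -/
def System.VanishesAt (ω : System) (g n k : ℕ) : Prop :=
  ∀ (J : List ℕ+) (K : List ℕ), J.length = n → K.length = k → ω g J K = 0

/-- All ways to split a list into two complementary sublists `(l₁, l₂)`, with the sign of the
permutation that takes the list to `l₁ ++ l₂`. -/
def splits {α : Type} : List α → List (ℤ × List α × List α)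
  | [] => [(1, [], [])]
  | a :: t => (splits t).flatMap fun p =>
      [(p.1, a :: p.2.1, p.2.2), (p.1 * (-1) ^ p.2.1.length, p.2.1, a :: p.2.2)]

namespace LocalSuperSpectralCurve

variable (S : LocalSuperSpectralCurve)

/-- `dξ_{-l}/dz = z^{-l-1} + ∑_{m ≥ 1} (φ_{lm}/l) z^{m-1}` for `l ≥ 1`. -/
def dxiNeg (l : ℕ+) : LaurentSeries ℂ :=
  HahnSeries.single (-(l : ℤ) - 1) 1 +
    HahnSeries.ofPowerSeries ℤ ℂ (PowerSeries.mk fun m => S.φ l m.succPNat / (l : ℂ))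

/-- `η_l/Θ`: it is `z^{l-1}` for `l > 0` and `z^{l-1} + ∑_{k ≥ 0} ψ_{-l,k} z^{k-1}` for `l ≤ 0`. -/
def eta (l : ℤ) : LaurentSeries ℂ :=
  HahnSeries.single (l - 1) 1 +
    if l ≤ 0 then zz⁻¹ * HahnSeries.ofPowerSeries ℤ ℂ (PowerSeries.mk fun k => S.ψ l.natAbs k) else 0

/-- The coefficient of `dξ_{-l}` in an element `f dz` of `V^{B-}`: the residue of `z^l f dz`. -/
def coordB (l : ℕ+) : LaurentSeries ℂ →+ ℂ :=
  (HahnSeries.coeff.addMonoidHom (-1 : ℤ)).comp (AddMonoidHom.mulLeft (zz ^ (l : ℕ)))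

/-- The coefficient of `η_{-l}` in an element `f Θ` of `V^{F0,-}`: the pairing with `η_l`. -/
def coordF (l : ℕ) : LaurentSeries ℂ →+ ℂ :=
  (HahnSeries.coeff.addMonoidHom (-1 : ℤ)).comp (AddMonoidHom.mulLeft (S.eta l * zz))

/-- `ω_{0,1|0}/dz = ∑_{l ≥ 1} τ_l z^{l-1}`. -/
def omega01 : LaurentSeries ℂ :=
  HahnSeries.ofPowerSeries ℤ ℂ (PowerSeries.mk fun l => S.τ l.succPNat)

/-- `ω_{0,2|0}(z,w|)/(dz dw) = 1/(z-w)² + ∑_{k,l ≥ 1} φ_{kl} z^{k-1} w^{l-1}`, for `|z| < |w|`. -/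
def omega02 : TwoVar :=
  1 / (varZ - varW) ^ 2 + doubleSeries fun a b => S.φ a.succPNat b.succPNat

/-- The coefficient of `z^{a-1} w^{b-1}`, `a, b ≥ 0`, in the regular part of `ω_{0,0|2}(|z,w)`. -/
def psiReg (a b : ℕ) : ℂ :=
  -((S.ψ b a - S.ψ a b) / (1 + if b * a = 0 then 1 else 0) / 2)

/-- `ω_{0,0|2}(|z,w)/(Θ_z Θ_w) = -(1/2) (z+w)/(z-w) 1/(zw)`
` - ∑_{k,l ≥ 1} (ψ_{k-1,l-1} - ψ_{l-1,k-1})/(1+δ_{(k-1)(l-1),0}) z^{l-1} w^{k-1}/(2zw)`,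
for `|z| < |w|`. -/
def omega00 : TwoVar :=
  -(1 / 2) * ((varZ + varW) / (varZ - varW)) * (1 / (varZ * varW)) +
    (1 / (varZ * varW)) * doubleSeries S.psiReg

/-- `ω_{0,2|0}(z,σ(z)|)/dz²`, where the second differential `dw` becomes `d(-z) = -dz`. -/
def omega02Diag : LaurentSeries ℂ :=
  -(1 / (zz - (-zz)) ^ 2 + HahnSeries.ofPowerSeries ℤ ℂ (PowerSeries.mk fun n =>
      ∑ p ∈ Finset.HasAntidiagonal.antidiagonal n, S.φ p.1.succPNat p.2.succPNat * (-1) ^ p.2))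

/-- The `z`-derivative of `-(1/2) (z+u)/((z-u) z u)`, by the quotient rule. -/
def dPolarF (z u : LaurentSeries ℂ) : LaurentSeries ℂ :=
  -(1 / 2) * (((z - u) * z * u - (z + u) * (2 * z * u - u ^ 2)) / ((z - u) * z * u) ^ 2)

/-- `𝓓_z ω_{0,0|2}(|z,u)` at `u = σ(z)`, divided by `dz Θ²`; the second summand is the sum of
`psiReg a b (a-1) z^{a-2} u^{b-1}` over `a, b ≥ 0`, at `u = -z`. -/
def dOmega00Diag : LaurentSeries ℂ :=
  dPolarF zz (-zz) + (zz ^ 3)⁻¹ * HahnSeries.ofPowerSeries ℤ ℂ (PowerSeries.mk fun n =>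
      ∑ p ∈ Finset.HasAntidiagonal.antidiagonal n, S.psiReg p.1 p.2 * ((p.1 : ℂ) - 1) * (-1) ^ (p.2 + 1))

/-! ### Recursion kernels -/

/-- `(ω_{0,1|0}(z|) - ω_{0,1|0}(σ(z)|))/dz`. -/
def kernelDenominator : LaurentSeries ℂ := S.omega01 - sigmaB S.omega01

/-- The kernel `K^{BB}(w,z,σ(z)) = ∫₀ᶻ ω_{0,2|0}(w,·|) / (ω_{0,1|0}(z|) - ω_{0,1|0}(σ(z)|))`. -/
def kernelBB : TwoVar := integrateZ S.omega02 / inZ S.kernelDenominator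

/-- The kernel
`K^{BF}(w,z,σ(z)) = (ω_{0,0|2}(|z,w) - η₀(z)η₀(w)/2) / (ω_{0,1|0}(z|) - ω_{0,1|0}(σ(z)|))`. -/
def kernelBF : TwoVar :=
  (S.omega00 - (1 / 2) * (inZ (S.eta 0) * inW (S.eta 0))) / inZ S.kernelDenominator

/-! ### The quadratic expressions

In what follows, a differential in a variable `z` and further variables is given by its series in `z`
for each choice of basis elements in the further variables, which are listed in `J` and `K`. -/

/-- `ω_{g,n+1|k}(z,J|K)`, where `ω_{0,1|0}` is replaced by `0` (the terms that involve it are left out in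
the recursion). -/
def legB (ω : System) (g : ℕ) (J : List ℕ+) (K : List ℕ) : LaurentSeries ℂ :=
  match g, J, K with
  | 0, [], [] => 0
  | 0, [i], [] => applyW (coordB i) S.omega02
  | g, J, K => ∑ᶠ i : ℕ+, HahnSeries.C (ω g (i :: J) K) * S.dxiNeg i

/-- `ω_{g,n|k+1}(J|z,K)`. -/
def legF (ω : System) (g : ℕ) (J : List ℕ+) (K : List ℕ) : LaurentSeries ℂ :=
  match g, J, K with
  | 0, [], [j] => applyW (S.coordF j) S.omega00
  | g, J, K => ∑ᶠ j : ℕ, HahnSeries.C (ω g J (j :: K)) * S.eta (-(j : ℤ))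

/-- `ω_{g,n+2|k}(z,σ(z),J|K)`. -/
def legBB (ω : System) (g : ℕ) (J : List ℕ+) (K : List ℕ) : LaurentSeries ℂ :=
  match g, J, K with
  | 0, [], [] => S.omega02Diag
  | g, J, K => ∑ᶠ p : ℕ+ × ℕ+,
      HahnSeries.C (ω g (p.1 :: p.2 :: J) K) * (S.dxiNeg p.1 * sigmaB (S.dxiNeg p.2))

/-- `ω_{g,n+1|k+1}(z,J|σ(z),K) + ω_{g,n+1|k+1}(σ(z),J|z,K)`. -/
def legBF (ω : System) (g : ℕ) (J : List ℕ+) (K : List ℕ) : LaurentSeries ℂ :=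
  ∑ᶠ p : ℕ+ × ℕ, HahnSeries.C (ω g (p.1 :: J) (p.2 :: K)) *
    (S.dxiNeg p.1 * sigmaF (S.eta (-(p.2 : ℤ))) + sigmaB (S.dxiNeg p.1) * S.eta (-(p.2 : ℤ)))

/-- `𝓓_z ω_{g,n|k+2}(J|z,u,K) + 𝓓_u ω_{g,n|k+2}(J|u,z,K)` at `u = σ(z)`, divided by `dz Θ²`. -/
def legFF (ω : System) (g : ℕ) (J : List ℕ+) (K : List ℕ) : LaurentSeries ℂ :=
  match g, J, K with
  | 0, [], [] => S.dOmega00Diag + sigmaB S.dOmega00Diag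
  | g, J, K => ∑ᶠ p : ℕ × ℕ, HahnSeries.C (ω g J (p.1 :: p.2 :: K)) *
      (dd (S.eta (-(p.1 : ℤ))) * sigmaF (S.eta (-(p.2 : ℤ))) +
        dd (sigmaF (S.eta (-(p.1 : ℤ)))) * S.eta (-(p.2 : ℤ)))

/-- `∑_{g₁+g₂=g} ∑_{J₁∪J₂=J, K₁∪K₂=K} (-1)^ρ f(g₁,J₁,K₁,g₂,J₂,K₂)`. -/
def sumSplits (f : ℕ → List ℕ+ → List ℕ → ℕ → List ℕ+ → List ℕ → LaurentSeries ℂ)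
    (g : ℕ) (J : List ℕ+) (K : List ℕ) : LaurentSeries ℂ :=
  ∑ p ∈ Finset.HasAntidiagonal.antidiagonal g,
    ((splits J).map fun a => ((splits K).map fun b =>
      b.1 • f p.1 a.2.1 b.2.1 p.2 a.2.2 b.2.2).sum).sum

/-- `Q̃^{FB}_{g,n|k+1}(J|z,K)/(dz Θ)`. -/
def quadFB (ω : System) (g : ℕ) (J : List ℕ+) (K : List ℕ) : LaurentSeries ℂ :=
  (match g with
    | 0 => 0
    | h + 1 => S.legBF ω h J K) +
  sumSplits (fun g₁ J₁ K₁ g₂ J₂ K₂ => S.legB ω g₁ J₁ K₁ * sigmaF (S.legF ω g₂ J₂ K₂)) g J K +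
  sumSplits (fun g₁ J₁ K₁ g₂ J₂ K₂ => sigmaB (S.legB ω g₁ J₁ K₁) * S.legF ω g₂ J₂ K₂) g J K

/-- `Q̃^{BB}_{g,n+1|k}(z,J|K)/dz²`. -/
def quadBB (ω : System) (g : ℕ) (J : List ℕ+) (K : List ℕ) : LaurentSeries ℂ :=
  (match g with
    | 0 => 0
    | h + 1 => S.legBB ω h J K) +
  sumSplits (fun g₁ J₁ K₁ g₂ J₂ K₂ => S.legB ω g₁ J₁ K₁ * sigmaB (S.legB ω g₂ J₂ K₂)) g J K

/-- `Q̃^{FF}_{g,n+1|k}(z,J|K)/dz²`; the factor `z` comes from `Θ² = z dz`. -/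
def quadFF (ω : System) (g : ℕ) (J : List ℕ+) (K : List ℕ) : LaurentSeries ℂ :=
  zz * (-(1 / 2) * (match g with
    | 0 => 0
    | h + 1 => S.legFF ω h J K) +
  (1 / 2) * sumSplits (fun g₁ J₁ K₁ g₂ J₂ K₂ =>
    dd (S.legF ω g₁ J₁ K₁) * sigmaF (S.legF ω g₂ J₂ K₂)) g J K +
  (1 / 2) * sumSplits (fun g₁ J₁ K₁ g₂ J₂ K₂ =>
    dd (sigmaF (S.legF ω g₁ J₁ K₁)) * S.legF ω g₂ J₂ K₂) g J K)

/-! ### Super topological recursion -/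

/-- The right-hand side of the bosonic recursion
`ω_{g,n+1|2m}(z₀,J|K) = Res_z K^{BB}(z₀,z,σ(z)) (Q̃^{BB}(z,J|K) + Q̃^{FF}(z,J|K))`:
the coefficient of `dξ_{-i}(z₀)`. -/
def bosonicRecursion (ω : System) (g : ℕ) (i : ℕ+) (J : List ℕ+) (K : List ℕ) : ℂ :=
  res (applyW (coordB i) S.kernelBB * (S.quadBB ω g J K + S.quadFF ω g J K))

/-- `ω̂_{g,n|2m+2}(J|u₁,u₂,K) = Res_z K^{BF}(u₁,z,σ(z)) Q̃^{FB}(J|z,u₂,K)`: the coefficient of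
`η_{-j₁}(u₁) η_{-j₂}(u₂)`; the factor `z` comes from `Θ² = z dz`. -/
def omegaHat (ω : System) (g : ℕ) (J : List ℕ+) (j₁ j₂ : ℕ) (K : List ℕ) : ℂ :=
  res (applyW (S.coordF j₁) S.kernelBF * S.quadFB ω g J (j₂ :: K) * zz)

/-- The right-hand side of the fermionic recursion
`ω_{g,n|2m+2}(J|u₁,u₂,K) = ω̂(J|u₁,u₂,K) - η₀(u₁) Res_z ω̂(J|u₂,z,K) η₀(z)`. -/
def fermionicRecursion (ω : System) (g : ℕ) (J : List ℕ+) (j₁ j₂ : ℕ) (K : List ℕ) : ℂ :=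
  S.omegaHat ω g J j₁ j₂ K -
    if j₁ = 0 then ∑ᶠ b : ℕ, S.omegaHat ω g J j₂ b K * OmegaF (S.eta (-(b : ℤ))) (S.eta 0) else 0

/-- One step of the recursion: `ω_{g,n|2m}` with `2g + n + 2m > 2` is computed by the bosonic recursion
if `n ≥ 1`, and by the fermionic recursion if `n = 0` and `m ≥ 1`. -/
def step (ω : System) (g : ℕ) (J : List ℕ+) (K : List ℕ) : ℂ :=
  if 2 < 2 * g + J.length + K.length ∧ Even K.length then
    match J, K with
    | i :: J, K => S.bosonicRecursion ω g i J K
    | [], j₁ :: j₂ :: K => S.fermionicRecursion ω g [] j₁ j₂ K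
    | [], _ => 0
  else 0

/-- The correlators `ω_{g,n|2m}`, `2g + n + 2m > 2`, `(n,m) ≠ (0,0)`, constructed by recursion on
`2g + n + 2m`. (The entries that the recursion does not produce are set to `0`; those with
`2g + n + 2m ≤ 2` are not read here, since `legB`, `legF`, `legBB` and `legFF` take them from the
curve.) -/
def correlator (g : ℕ) (J : List ℕ+) (K : List ℕ) : ℂ :=
  S.step (fun g' J' K' =>
    if _h : 2 * g' + J'.length + K'.length < 2 * g + J.length + K.length then
      correlator g' J' K' else 0) g J K
termination_by 2 * g + J.length + K.length

/-- `ω` is an output of super topological recursion on `S`: there are no correlators with an odd number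
of fermionic entries, and for `2g + n + 2m > 2` both the bosonic recursion (if `n ≥ 1`) and the
fermionic recursion (if `m ≥ 1`) hold. -/
structure SatisfiesRecursion (ω : System) : Prop where
  odd : ∀ g J K, Odd (List.length K) → ω g J K = 0
  bosonic : ∀ g i J K, Even (List.length K) → 2 < 2 * g + (List.length J + 1) + List.length K →
    ω g (i :: J) K = S.bosonicRecursion ω g i J K
  fermionic : ∀ g J j₁ j₂ K, Even (List.length K) → 2 < 2 * g + List.length J + (List.length K + 2) →
    ω g J (j₁ :: j₂ :: K) = S.fermionicRecursion ω g J j₁ j₂ K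

end LocalSuperSpectralCurve

end

end SuperTR

/-! In genus zero with at most one bosonic entry, only products of lower correlators enter the
recursion, and the proof is an induction on the number of entries. Let f_a(z)/z be the
η_{-a}-coordinate of ω_{0,0|2}(|z,·), and let M_ab be the 2×2 minor of the coefficients of 1 and z²
in f_a and f_b.

The kernel denominator vanishes to order at most two, so the residue for ω_{0,1|2} sees very few
coefficients: its coordinates are c·M_ab along dξ_{-1} and zero along the other dξ_{-i}, with c
depending on the curve alone (`exists_bosonicRecursion_pair`).

For ω_{0,0|4} the quadratic expression is built from dξ_{-1} and from the combination g = M_ab f_d -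
M_ad f_b + M_bd f_a. The coefficients of 1 and z² in g are 3×3 determinants with a repeated row,
hence zero; together with the symmetry under σ this leaves no residue (`quadFB_triple`,
`omegaHat_eq_zero`). For ω_{0,1|4} the bosonic part is a multiple of the Plücker relation among the
M_ab (`quadBB_quadruple`), and the fermionic part contains ω_{0,0|4}.

With more entries every product has a factor that vanishes by induction, by parity, or because
ω_{0,1|0} is omitted (`quadFB_eq_zero`, `quadBB_eq_zero`, `quadFF_eq_zero`). -/

namespace SuperTR

noncomputable section

/-! ### Laurent series as shifted power series -/

section Laurent

variable {R : Type*} [CommRing R]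

/-- The Laurent series `z^n p(z)` for a power series `p`. -/
def laurent (n : ℤ) (p : PowerSeries R) : LaurentSeries R :=
  HahnSeries.single n 1 * HahnSeries.ofPowerSeries ℤ R p

theorem coeff_laurent_add (n : ℤ) (p : PowerSeries R) (k : ℕ) :
    (laurent n p).coeff (n + k) = PowerSeries.coeff k p := by
  rw [laurent, HahnSeries.coeff_single_mul, one_mul, add_sub_cancel_left,
    HahnSeries.ofPowerSeries_apply_coeff]

theorem coeff_laurent_of_lt {n k : ℤ} (h : k < n) (p : PowerSeries R) :
    (laurent n p).coeff k = 0 := by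
  rw [laurent, HahnSeries.coeff_single_mul, one_mul, PowerSeries.coeff_coe, if_pos (by lia)]

theorem eq_laurent {n : ℤ} {f : LaurentSeries R} {p : PowerSeries R}
    (h₀ : ∀ k < n, f.coeff k = 0) (h : ∀ k : ℕ, f.coeff (n + k) = PowerSeries.coeff k p) :
    f = laurent n p := by
  ext k
  rcases lt_or_ge k n with hk | hk
  · rw [h₀ k hk, coeff_laurent_of_lt hk]
  · obtain ⟨m, rfl⟩ := Int.le.dest hk
    rw [h, coeff_laurent_add]

theorem laurent_mul (m n : ℤ) (p q : PowerSeries R) :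
    laurent m p * laurent n q = laurent (m + n) (p * q) := by
  rw [laurent, laurent, laurent, map_mul, mul_mul_mul_comm, HahnSeries.single_mul_single, one_mul]

theorem laurent_add (n : ℤ) (p q : PowerSeries R) :
    laurent n p + laurent n q = laurent n (p + q) := by
  simp only [laurent, map_add, mul_add]

theorem laurent_sub (n : ℤ) (p q : PowerSeries R) :
    laurent n p - laurent n q = laurent n (p - q) := by
  simp only [laurent, map_sub, mul_sub]

theorem laurent_neg (n : ℤ) (p : PowerSeries R) : -laurent n p = laurent n (-p) := by
  simp only [laurent, map_neg, mul_neg]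

theorem C_mul_laurent (n : ℤ) (c : R) (p : PowerSeries R) :
    HahnSeries.C c * laurent n p = laurent n (PowerSeries.C c * p) := by
  simp only [laurent, map_mul, HahnSeries.ofPowerSeries_C]
  ring

theorem ofPowerSeries_eq_laurent (p : PowerSeries R) :
    HahnSeries.ofPowerSeries ℤ R p = laurent 0 p := by
  exact (one_mul _).symm

theorem single_eq_laurent (n : ℤ) : (HahnSeries.single n 1 : LaurentSeries R) = laurent n 1 := by
  rw [laurent, map_one (HahnSeries.ofPowerSeries ℤ R), mul_one]

theorem laurent_X_mul (n : ℤ) (p : PowerSeries R) :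
    laurent n (PowerSeries.X * p) = laurent (n + 1) p := by
  rw [laurent, laurent, map_mul, HahnSeries.ofPowerSeries_X, ← mul_assoc,
    HahnSeries.single_mul_single, one_mul]

end Laurent

theorem zz_eq_laurent : zz = laurent 1 1 := single_eq_laurent 1

/-- With `laurent_mul`, this turns each residue that has to be computed into one coefficient of a
product of power series. -/
theorem res_laurent (k : ℕ) (p : PowerSeries ℂ) :
    res (laurent (-1 - (k : ℤ)) p) = PowerSeries.coeff k p := by
  rw [res, ← coeff_laurent_add (-1 - (k : ℤ)) p k]
  congr 1
  ring

theorem reflect_laurent (n : ℤ) (p : PowerSeries ℂ) :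
    reflect (laurent n p) =
      laurent n (PowerSeries.C ((-1) ^ n) * PowerSeries.rescale (-1) p) := by
  refine eq_laurent (fun k hk => ?_) fun k => ?_
  · simp [reflect, coeff_laurent_of_lt hk]
  · simp only [reflect, coeff_laurent_add, PowerSeries.coeff_C_mul, PowerSeries.coeff_rescale]
    rw [zpow_add₀ (by norm_num), zpow_natCast]
    ring

theorem dd_laurent (n : ℤ) (p : PowerSeries ℂ) :
    dd (laurent n p) =
      laurent (n - 1) (PowerSeries.mk fun k => ((n : ℂ) + k) * PowerSeries.coeff k p) := by
  have key : ∀ k : ℤ, (dd (laurent n p)).coeff k = ((k : ℂ) + 1) * (laurent n p).coeff (k + 1) := by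
    intro k
    simp [dd]
  refine eq_laurent (fun k hk => ?_) fun k => ?_
  · rw [key, coeff_laurent_of_lt (by lia), mul_zero]
  · rw [key, show n - 1 + (k : ℤ) + 1 = n + k by ring, coeff_laurent_add, PowerSeries.coeff_mk]
    push_cast
    ring

/-! ### Functionals in the second variable -/

theorem coeff_applyW (φ : LaurentSeries ℂ →+ ℂ) (f : TwoVar) (n : ℤ) :
    (applyW φ f).coeff n = φ (f.coeff n) := rfl

theorem applyW_laurent (φ : LaurentSeries ℂ →+ ℂ) (n : ℤ) (p : PowerSeries (LaurentSeries ℂ)) :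
    applyW φ (laurent n p) = laurent n (PowerSeries.mk fun k => φ (PowerSeries.coeff k p)) := by
  refine eq_laurent (fun k hk => ?_) fun k => ?_
  · rw [coeff_applyW, coeff_laurent_of_lt hk, map_zero]
  · rw [coeff_applyW, coeff_laurent_add, PowerSeries.coeff_mk]

theorem applyW_mul_inZ {φ : LaurentSeries ℂ →+ ℂ}
    (hφ : ∀ c f, φ (HahnSeries.C c * f) = c * φ f) (G : TwoVar) (f : LaurentSeries ℂ) :
    applyW φ (G * inZ f) = applyW φ G * f := by
  ext n
  -- Enlarging one support on each side makes both coefficients sums over the same finite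
  -- antidiagonal, where linearity of φ applies term by term.
  have h₁ : (inZ f).support ⊆ f.support := fun k hk h => hk (by simp [inZ, h])
  have h₂ : (applyW φ G).support ⊆ G.support := fun k hk h => hk (by simp [coeff_applyW, h])
  rw [coeff_applyW, HahnSeries.coeff_mul_right' f.isPWO_support h₁,
    HahnSeries.coeff_mul_left' G.isPWO_support h₂, map_sum]
  refine Finset.sum_congr rfl fun p _ => ?_
  rw [coeff_applyW, mul_comm, mul_comm (φ _)]
  exact hφ _ _

theorem inZ_laurent (n : ℤ) (p : PowerSeries ℂ) :
    inZ (laurent n p) = laurent n (p.map HahnSeries.C) := by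
  refine eq_laurent (fun k hk => ?_) fun k => ?_
  · simp [inZ, coeff_laurent_of_lt hk]
  · simp [inZ, coeff_laurent_add]

theorem inZ_ne_zero {f : LaurentSeries ℂ} (hf : f ≠ 0) : inZ f ≠ 0 := by
  contrapose! hf
  ext n
  simpa [inZ] using congrArg (fun g : TwoVar => g.coeff n) hf

theorem applyW_div_inZ {φ : LaurentSeries ℂ →+ ℂ}
    (hφ : ∀ c f, φ (HahnSeries.C c * f) = c * φ f) (G : TwoVar) {f : LaurentSeries ℂ}
    (hf : f ≠ 0) : applyW φ (G / inZ f) = applyW φ G * f⁻¹ := by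
  have h : G / inZ f * inZ f = G := by
    have := inZ_ne_zero hf
    field_simp
  rw [eq_mul_inv_iff_mul_eq₀ hf, ← applyW_mul_inZ hφ, h]

namespace LocalSuperSpectralCurve

variable (S : LocalSuperSpectralCurve)

theorem coordB_C_mul (l : ℕ+) (c : ℂ) (f : LaurentSeries ℂ) :
    coordB l (HahnSeries.C c * f) = c * coordB l f := by
  have : zz ^ (l : ℕ) * (HahnSeries.C c * f) = HahnSeries.C c * (zz ^ (l : ℕ) * f) := by ring
  simp only [coordB, AddMonoidHom.comp_apply, AddMonoidHom.coe_mulLeft, this]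
  exact HahnSeries.coeff_single_zero_mul

theorem coordF_C_mul (l : ℕ) (c : ℂ) (f : LaurentSeries ℂ) :
    S.coordF l (HahnSeries.C c * f) = c * S.coordF l f := by
  have : S.eta l * zz * (HahnSeries.C c * f) = HahnSeries.C c * (S.eta l * zz * f) := by ring
  simp only [coordF, AddMonoidHom.comp_apply, AddMonoidHom.coe_mulLeft, this]
  exact HahnSeries.coeff_single_zero_mul

/-! ### Expansions of the curve data -/

/-- The missing z⁻¹ term is needed in `quadFB_triple`, where it removes the one product that the
determinant identities do not reach. -/
theorem exists_dxiNeg_one : ∃ h : PowerSeries ℂ, S.dxiNeg 1 = laurent (-2) h ∧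
    PowerSeries.coeff 0 h = 1 ∧ PowerSeries.coeff 1 h = 0 := by
  refine ⟨1 + PowerSeries.X * (PowerSeries.X *
    PowerSeries.mk fun m => S.φ 1 m.succPNat / ((1 : ℕ+) : ℂ)), ?_, ?_, ?_⟩
  · rw [← laurent_add, laurent_X_mul, laurent_X_mul, dxiNeg, single_eq_laurent,
      ofPowerSeries_eq_laurent]
    norm_num
  · simp
  · rw [map_add, ← zero_add 1, PowerSeries.coeff_succ_X_mul]
    simp [PowerSeries.coeff_one]

/-- The kernel denominator vanishes to order at most two. -/
theorem exists_inv_kernelDenominator :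
    S.kernelDenominator ≠ 0 ∧ ∃ u : PowerSeries ℂ, S.kernelDenominator⁻¹ = laurent (-2) u := by
  have hc : S.kernelDenominator = laurent 0 (PowerSeries.mk fun l =>
      (1 + (-1) ^ l) * S.τ l.succPNat) := by
    rw [kernelDenominator, omega01, sigmaB, ofPowerSeries_eq_laurent, reflect_laurent, laurent_neg,
      laurent_sub]
    congr 1
    ext l
    simp
    ring
  set d : PowerSeries ℂ := PowerSeries.mk fun l => (1 + (-1) ^ l) * S.τ l.succPNat with hd
  have hinv : ∀ (n : ℤ) (e : PowerSeries ℂ), PowerSeries.constantCoeff e ≠ 0 →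
      laurent n e * laurent (-n) e⁻¹ = 1 := by
    intro n e he
    rw [laurent_mul, PowerSeries.mul_inv_cancel e he, add_neg_cancel, ← single_eq_laurent]
    rfl
  -- Only even powers survive in d, so it starts with 2τ₁ or, if τ₁ = 0, with 2τ₃z².
  by_cases h1 : S.τ 1 = 0
  · have h3 : S.τ 3 ≠ 0 := by
      intro h
      simpa [h1, h] using S.admissible
    obtain ⟨e, he⟩ : PowerSeries.X ^ 2 ∣ d := by
      rw [PowerSeries.X_pow_dvd_iff]
      intro m hm
      interval_cases m
      · simp only [hd, PowerSeries.coeff_mk]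
        exact mul_eq_zero_of_right _ h1
      · simp [hd]
    have he0 : PowerSeries.constantCoeff e ≠ 0 := by
      have : PowerSeries.coeff (0 + 2) d = PowerSeries.coeff 0 e := by
        rw [he, PowerSeries.coeff_X_pow_mul]
      rw [← PowerSeries.coeff_zero_eq_constantCoeff_apply, ← this, hd, PowerSeries.coeff_mk]
      refine mul_ne_zero (by norm_num) h3
    have hD : S.kernelDenominator = laurent 2 e := by
      rw [hc, he, pow_two, mul_assoc, laurent_X_mul, laurent_X_mul]
      norm_num
    have := hinv 2 e he0
    rw [← hD] at this
    exact ⟨left_ne_zero_of_mul_eq_one this, e⁻¹, (eq_inv_of_mul_eq_one_right this).symm⟩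
  · have hd0 : PowerSeries.constantCoeff d ≠ 0 := by
      rw [← PowerSeries.coeff_zero_eq_constantCoeff_apply, hd, PowerSeries.coeff_mk]
      exact mul_ne_zero (by norm_num) h1
    have := hinv 0 d hd0
    rw [← hc] at this
    -- The denominator is a unit here; the padding by z² gives u constant term 0, so that ω_{0,1|2}
    -- vanishes in this case.
    refine ⟨left_ne_zero_of_mul_eq_one this, PowerSeries.X * (PowerSeries.X * d⁻¹), ?_⟩
    rw [laurent_X_mul, laurent_X_mul, ← eq_inv_of_mul_eq_one_right this]
    norm_num

theorem exists_inv_varZ_sub_varW : ∃ G : PowerSeries (LaurentSeries ℂ),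
    (varZ - varW)⁻¹ = laurent 0 G ∧ PowerSeries.constantCoeff G = -zz⁻¹ := by
  have hz : zz ≠ 0 := by simp [zz]
  set P : PowerSeries (LaurentSeries ℂ) := PowerSeries.X - PowerSeries.C zz with hP
  have hP0 : PowerSeries.constantCoeff P = -zz := by simp [hP]
  have hv : varZ - varW = laurent 0 P := by
    rw [← ofPowerSeries_eq_laurent, hP, map_sub, HahnSeries.ofPowerSeries_X,
      HahnSeries.ofPowerSeries_C]
    rfl
  refine ⟨P⁻¹, ?_, ?_⟩
  · refine (eq_inv_of_mul_eq_one_right ?_).symm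
    rw [hv, laurent_mul, PowerSeries.mul_inv_cancel P (by simpa [hP0] using hz),
      add_zero, ← ofPowerSeries_eq_laurent, map_one]
  · rw [PowerSeries.constantCoeff_inv, hP0]
    field_simp

/-- At z = 0 the function 1/(z-w)² is w⁻², up to terms regular in w. Hence the leading coefficient
in z only has a dξ_{-1}-coordinate, which singles out i = 1 later on. -/
theorem exists_integrateZ_omega02 : ∃ p : PowerSeries (LaurentSeries ℂ),
    integrateZ S.omega02 = laurent 1 p ∧ ∃ q : PowerSeries ℂ,
      PowerSeries.constantCoeff p = laurent (-2) 1 + laurent 0 q := by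
  obtain ⟨G, hG, hG0⟩ := exists_inv_varZ_sub_varW
  set Φ : PowerSeries (LaurentSeries ℂ) := PowerSeries.mk fun a =>
    HahnSeries.ofPowerSeries ℤ ℂ (PowerSeries.mk fun b => S.φ a.succPNat b.succPNat) with hΦ
  have h : S.omega02 = laurent 0 (G * G + Φ) := by
    have : 1 / (varZ - varW) ^ 2 = (varZ - varW)⁻¹ * (varZ - varW)⁻¹ := by field_simp
    rw [omega02, this, hG, laurent_mul, doubleSeries, ofPowerSeries_eq_laurent, ← laurent_add,
      add_zero]
  refine ⟨PowerSeries.mk fun k => HahnSeries.C ((k : ℂ) + 1)⁻¹ * PowerSeries.coeff k (G * G + Φ),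
    ?_, PowerSeries.mk fun b => S.φ (Nat.succPNat 0) b.succPNat, ?_⟩
  · have hZ : varZ = laurent 1 1 := single_eq_laurent 1
    rw [integrateZ, h, hZ, ← one_mul (PowerSeries.mk _), ← add_zero (1 : ℤ), ← laurent_mul]
    congr 1
    refine eq_laurent (fun k hk => ?_) fun k => ?_
    · simp [coeff_laurent_of_lt hk]
    · simp only [coeff_laurent_add, PowerSeries.coeff_mk]
      simp
  · have hzz : zz⁻¹ * zz⁻¹ = laurent (-2) 1 := by
      rw [← single_eq_laurent, zz, HahnSeries.inv_single, HahnSeries.single_mul_single]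
      norm_num
    have hGG : -zz⁻¹ * -zz⁻¹ = laurent (-2) 1 := by rw [← hzz]; ring
    rw [← PowerSeries.coeff_zero_eq_constantCoeff_apply, PowerSeries.coeff_mk, map_add,
      PowerSeries.coeff_zero_eq_constantCoeff_apply, map_mul, hG0, hGG, hΦ, PowerSeries.coeff_mk,
      ofPowerSeries_eq_laurent]
    simp

theorem coordB_leading (i : ℕ+) (q : PowerSeries ℂ) :
    coordB i (laurent (-2) 1 + laurent 0 q) = if i = 1 then 1 else 0 := by
  have hz : zz ^ (i : ℕ) = laurent (i : ℤ) 1 := by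
    rw [← single_eq_laurent, zz, HahnSeries.single_pow]
    simp
  rw [map_add]
  simp only [coordB, AddMonoidHom.comp_apply, AddMonoidHom.coe_mulLeft, hz, laurent_mul]
  have hi := i.pos
  change (laurent _ _).coeff (-1) + (laurent _ _).coeff (-1) = _
  rw [coeff_laurent_of_lt (by lia : (-1 : ℤ) < i + 0), add_zero, mul_one, ← single_eq_laurent,
    HahnSeries.coeff_single]
  have h : (-1 : ℤ) = (i : ℕ) + -2 ↔ i = 1 := by
    rw [← PNat.coe_eq_one_iff]
    lia
  simp only [h]

theorem applyW_coordB_kernelBB (i : ℕ+) : ∃ p : PowerSeries ℂ,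
    applyW (coordB i) S.kernelBB = laurent 1 p * S.kernelDenominator⁻¹ ∧
      PowerSeries.coeff 0 p = if i = 1 then 1 else 0 := by
  obtain ⟨p, hp, q, hq⟩ := S.exists_integrateZ_omega02
  refine ⟨PowerSeries.mk fun k => coordB i (PowerSeries.coeff k p), ?_, ?_⟩
  · rw [kernelBB, applyW_div_inZ (coordB_C_mul i) _ S.exists_inv_kernelDenominator.1, hp,
      applyW_laurent]
  · rw [PowerSeries.coeff_mk, PowerSeries.coeff_zero_eq_constantCoeff_apply, hq, coordB_leading]

theorem eta_zero_eq_laurent :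
    S.eta 0 = laurent (-1) (1 + PowerSeries.mk fun k => S.ψ 0 k) := by
  have h : zz⁻¹ = laurent (-1) 1 := by
    rw [← single_eq_laurent, zz, HahnSeries.inv_single, inv_one]
  rw [eta, if_pos le_rfl, h, ← laurent_add, single_eq_laurent, ofPowerSeries_eq_laurent,
    laurent_mul, one_mul, add_zero, zero_sub, Int.natAbs_zero]

/-- Since ψ₀₀ = 0, the relation with k = 0 reads ψ_{b0} = -ψ_{0b}; the Kronecker delta halves the
doubled term. -/
theorem two_mul_psiReg_zero (b : ℕ) : 2 * S.psiReg 0 b = S.ψ 0 b := by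
  have h := S.ψ_rel 0 b
  rw [S.ψ_zero] at h
  simp only [psiReg, mul_zero, if_true]
  linear_combination -h / 2

theorem two_ne_zero_twoVar : (2 : TwoVar) ≠ 0 := by
  rw [← map_ofNat (HahnSeries.C : LaurentSeries ℂ →+* TwoVar) 2,
    ← map_ofNat (HahnSeries.C : ℂ →+* LaurentSeries ℂ) 2]
  simp

theorem half_twoVar : (1 / 2 : TwoVar) = HahnSeries.C (HahnSeries.C (1 / 2)) := by
  have h2 : (2 : TwoVar) * HahnSeries.C (HahnSeries.C (1 / 2)) = 1 := by
    rw [← map_ofNat (HahnSeries.C : LaurentSeries ℂ →+* TwoVar) 2,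
      ← map_ofNat (HahnSeries.C : ℂ →+* LaurentSeries ℂ) 2, ← map_mul, ← map_mul]
    norm_num
  have := two_ne_zero_twoVar
  field_simp
  rw [h2]

/-- Partial fractions: -(z+w)/(2zw(z-w)) = 1/(2zw) - 1/(w(z-w)), which isolates the pole at z = 0.
-/
theorem omega00_eq : S.omega00 = varZ⁻¹ * (varW⁻¹ * (1 / 2 + doubleSeries S.psiReg)) -
    varW⁻¹ * (varZ - varW)⁻¹ := by
  have h2 := two_ne_zero_twoVar
  have hZ : varZ ≠ 0 := by simp [varZ]
  have hW : varW ≠ 0 := by simp [varW, zz]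
  have hZW : varZ - varW ≠ 0 := by
    intro h
    have := congrArg (fun f : TwoVar => f.coeff 1) h
    simp [varZ, varW] at this
  rw [omega00]
  field_simp
  ring

/-- The polar part of `ω_{0,0|2}(|z,w)` at `z = 0` is that of `η₀(z) η₀(w) / 2`. -/
theorem exists_omega00_sub : ∃ H : PowerSeries (LaurentSeries ℂ),
    S.omega00 - (1 / 2) * (inZ (S.eta 0) * inW (S.eta 0)) = laurent 0 H := by
  obtain ⟨G, hG, hG0⟩ := exists_inv_varZ_sub_varW
  have hz : zz ≠ 0 := by simp [zz]
  have hZ : varZ⁻¹ = laurent (-1) 1 := by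
    rw [← single_eq_laurent, varZ, HahnSeries.inv_single, inv_one]
  have hW : varW⁻¹ = HahnSeries.C zz⁻¹ := by
    refine (eq_inv_of_mul_eq_one_right ?_).symm
    rw [varW, ← map_mul, mul_inv_cancel₀ hz, map_one]
  set Ψ : PowerSeries (LaurentSeries ℂ) := PowerSeries.mk fun a =>
    HahnSeries.ofPowerSeries ℤ ℂ (PowerSeries.mk fun b => S.psiReg a b) with hΨ
  set e : PowerSeries ℂ := 1 + PowerSeries.mk fun k => S.ψ 0 k with he
  have hη : S.eta 0 = laurent (-1) e := S.eta_zero_eq_laurent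
  -- Divisibility by z says that the coefficients of z⁻¹ agree: on one side w⁻¹(1/2 + ∑ `psiReg 0 b`
  -- w^b), on the other η₀(w)/2, as ψ₀₀ = 0 makes e start with 1.
  obtain ⟨P, hP⟩ : PowerSeries.X ∣
      PowerSeries.C zz⁻¹ * (PowerSeries.C (HahnSeries.C (1 / 2)) + Ψ) -
        PowerSeries.C (HahnSeries.C (1 / 2)) * (e.map HahnSeries.C * PowerSeries.C (S.eta 0)) := by
    have h1 : zz⁻¹ = laurent (-1) 1 := by
      rw [← single_eq_laurent, zz, HahnSeries.inv_single, inv_one]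
    have h3 : (HahnSeries.C (1 / 2) : LaurentSeries ℂ) = laurent 0 (PowerSeries.C (1 / 2)) := by
      rw [← ofPowerSeries_eq_laurent, HahnSeries.ofPowerSeries_C]
    have h4 : PowerSeries.constantCoeff (e.map (HahnSeries.C : ℂ →+* LaurentSeries ℂ)) = 1 := by
      rw [← PowerSeries.coeff_zero_eq_constantCoeff_apply, PowerSeries.coeff_map, he, map_add,
        PowerSeries.coeff_mk, S.ψ_zero, add_zero]
      simp
    have h5 : PowerSeries.constantCoeff Ψ = laurent 0 (PowerSeries.mk fun b => S.psiReg 0 b) := by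
      rw [← PowerSeries.coeff_zero_eq_constantCoeff_apply, hΨ, PowerSeries.coeff_mk,
        ofPowerSeries_eq_laurent]
    rw [PowerSeries.X_dvd_iff]
    simp only [map_sub, map_mul, map_add, PowerSeries.constantCoeff_C]
    rw [h4, h5, one_mul, h1, S.eta_zero_eq_laurent, h3, laurent_add, laurent_mul, laurent_mul,
      one_mul, zero_add, add_zero, laurent_sub]
    suffices h : PowerSeries.C (1 / 2) + PowerSeries.mk (fun b => S.psiReg 0 b) -
        PowerSeries.C (1 / 2) * e = 0 by
      rw [h, laurent, map_zero, mul_zero]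
    ext b
    have := S.two_mul_psiReg_zero b
    simp only [he, mul_add, mul_one, map_sub, map_add, PowerSeries.coeff_C_mul,
      PowerSeries.coeff_mk, map_zero]
    linear_combination this / 2
  refine ⟨P - PowerSeries.C zz⁻¹ * G, ?_⟩
  rw [S.omega00_eq, half_twoVar, hG, hW, hZ, doubleSeries, ← hΨ, hη, inZ_laurent, inW, ← hη, ← laurent_sub, show laurent 0 P = laurent (-1 + 1) P by norm_num,
    ← laurent_X_mul, ← hP, ← ofPowerSeries_eq_laurent, ← ofPowerSeries_eq_laurent]
  simp only [laurent, map_mul, map_add, map_sub, map_one (HahnSeries.ofPowerSeries ℤ (LaurentSeries ℂ)),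
    HahnSeries.ofPowerSeries_C]
  ring

theorem exists_applyW_omega00 (j : ℕ) : ∃ f : PowerSeries ℂ,
    applyW (S.coordF j) S.omega00 = laurent (-1) f := by
  obtain ⟨H, hH⟩ := S.exists_omega00_sub
  have h : S.omega00 = laurent 0 H + (1 / 2) * (inZ (S.eta 0) * inW (S.eta 0)) := by
    rw [← hH]
    ring
  rw [h, half_twoVar, S.eta_zero_eq_laurent, inZ_laurent, inW, mul_comm (laurent _ _),
    C_mul_laurent, C_mul_laurent, show (0 : ℤ) = -1 + 1 by norm_num, ← laurent_X_mul, laurent_add,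
    applyW_laurent]
  exact ⟨_, rfl⟩

theorem applyW_coordF_kernelBF (j : ℕ) : ∃ p : PowerSeries ℂ,
    applyW (S.coordF j) S.kernelBF = laurent 0 p * S.kernelDenominator⁻¹ := by
  obtain ⟨H, hH⟩ := S.exists_omega00_sub
  exact ⟨_, by rw [kernelBF, applyW_div_inZ (S.coordF_C_mul j) _ S.exists_inv_kernelDenominator.1,
    hH, applyW_laurent]⟩

end LocalSuperSpectralCurve

/-! ### Reflection, low coefficients and splittings -/

theorem half_laurentSeries : (1 / 2 : LaurentSeries ℂ) = HahnSeries.C (1 / 2) := by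
  rw [map_div₀, map_one, map_ofNat]

theorem reflect_zero : reflect 0 = 0 := by
  ext n
  simp [reflect]

theorem reflect_add (f g : LaurentSeries ℂ) : reflect (f + g) = reflect f + reflect g := by
  ext n
  simp [reflect, mul_add]

theorem reflect_sub (f g : LaurentSeries ℂ) : reflect (f - g) = reflect f - reflect g := by
  ext n
  simp [reflect, mul_sub]

theorem reflect_C_mul (x : ℂ) (f : LaurentSeries ℂ) :
    reflect (HahnSeries.C x * f) = HahnSeries.C x * reflect f := by
  ext n
  simp [reflect, HahnSeries.C_apply]
  ring

theorem reflect_laurent_neg_one (p : PowerSeries ℂ) :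
    reflect (laurent (-1) p) = laurent (-1) (-PowerSeries.rescale (-1) p) := by
  rw [reflect_laurent]
  norm_num

theorem reflect_laurent_neg_two (p : PowerSeries ℂ) :
    reflect (laurent (-2) p) = laurent (-2) (PowerSeries.rescale (-1) p) := by
  rw [reflect_laurent]
  norm_num

section LowCoefficients

variable {R : Type*} [CommRing R] (p q : PowerSeries R)

theorem coeff_zero_mul_eq : PowerSeries.coeff 0 (p * q) =
    PowerSeries.coeff 0 p * PowerSeries.coeff 0 q := by
  simp

theorem coeff_one_mul_eq : PowerSeries.coeff 1 (p * q) =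
    PowerSeries.coeff 0 p * PowerSeries.coeff 1 q +
      PowerSeries.coeff 1 p * PowerSeries.coeff 0 q := by
  simp [PowerSeries.coeff_mul, Finset.Nat.antidiagonal_succ]

theorem coeff_two_mul_eq : PowerSeries.coeff 2 (p * q) =
    PowerSeries.coeff 0 p * PowerSeries.coeff 2 q + PowerSeries.coeff 1 p * PowerSeries.coeff 1 q +
      PowerSeries.coeff 2 p * PowerSeries.coeff 0 q := by
  simp [PowerSeries.coeff_mul, Finset.Nat.antidiagonal_succ, add_assoc]

theorem coeff_three_mul_eq : PowerSeries.coeff 3 (p * q) =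
    PowerSeries.coeff 0 p * PowerSeries.coeff 3 q + PowerSeries.coeff 1 p * PowerSeries.coeff 2 q +
      PowerSeries.coeff 2 p * PowerSeries.coeff 1 q +
      PowerSeries.coeff 3 p * PowerSeries.coeff 0 q := by
  simp [PowerSeries.coeff_mul, Finset.Nat.antidiagonal_succ, add_assoc]

end LowCoefficients

theorem length_add_length_of_mem_splits {α : Type} {K : List α} {b : ℤ × List α × List α}
    (hb : b ∈ splits K) : b.2.1.length + b.2.2.length = K.length := by
  induction K generalizing b with
  | nil => simp_all [splits]
  | cons a t ih =>
    simp only [splits, List.mem_flatMap, List.mem_cons, List.not_mem_nil, or_false] at hb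
    obtain ⟨p, hp, rfl | rfl⟩ := hb <;> have := ih hp <;> simp only [List.length_cons] <;> lia

namespace LocalSuperSpectralCurve

variable (S : LocalSuperSpectralCurve)

theorem sumSplits_zero_nil (f : ℕ → List ℕ+ → List ℕ → ℕ → List ℕ+ → List ℕ → LaurentSeries ℂ)
    (K : List ℕ) : sumSplits f 0 [] K =
      ((splits K).map fun b => b.1 • f 0 [] b.2.1 0 [] b.2.2).sum := by
  simp [sumSplits, splits]

theorem sumSplits_eq_zero {f : ℕ → List ℕ+ → List ℕ → ℕ → List ℕ+ → List ℕ → LaurentSeries ℂ}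
    {K : List ℕ} (h : ∀ K₁ K₂ : List ℕ, K₁.length + K₂.length = K.length →
      f 0 [] K₁ 0 [] K₂ = 0) : sumSplits f 0 [] K = 0 := by
  rw [sumSplits_zero_nil]
  refine List.sum_eq_zero fun x hx => ?_
  obtain ⟨b, hb, rfl⟩ := List.mem_map.1 hx
  rw [h _ _ (length_add_length_of_mem_splits hb), smul_zero]

variable {ω : System}

theorem legB_eq_zero {K : List ℕ} (h : ∀ i, ω 0 [i] K = 0) : S.legB ω 0 [] K = 0 := by
  cases K <;> simp [legB, h]

theorem legF_eq_zero {K : List ℕ} (hK : K.length ≠ 1) (h : ∀ j, ω 0 [] (j :: K) = 0) :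
    S.legF ω 0 [] K = 0 := by
  match K with
  | [] => simp [legF, h]
  | [_] => simp at hK
  | _ :: _ :: _ => simp [legF, h]

/-! ### The correlator `ω_{0,1|2}` -/

/-- The two-by-two determinant of the coefficients of `z^{-1}` and `z` in `z⁻¹ f_a` and `z⁻¹ f_b`. -/
def minor (f : ℕ → PowerSeries ℂ) (a b : ℕ) : ℂ :=
  PowerSeries.coeff 0 (f a) * PowerSeries.coeff 2 (f b) -
    PowerSeries.coeff 2 (f a) * PowerSeries.coeff 0 (f b)

theorem legB_singleton (hodd : ∀ J K, Odd (List.length K) → ω 0 J K = 0) (a : ℕ) :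
    S.legB ω 0 [] [a] = 0 :=
  S.legB_eq_zero fun i => hodd _ _ (by simp)

theorem quadBB_pair (hodd : ∀ J K, Odd (List.length K) → ω 0 J K = 0) (a b : ℕ) :
    S.quadBB ω 0 [] [a, b] = 0 := by
  have h₀ : S.legB ω 0 [] [] = 0 := rfl
  rw [quadBB, sumSplits_zero_nil]
  simp [splits, h₀, S.legB_singleton hodd, sigmaB, reflect_zero]

/-- The odd coefficient vanishes because the expression is even in z. Antisymmetry in a and b
removes the products of coefficients of equal index, so the minor is all that is left up to order
two. -/
theorem quadFF_pair (hodd : ∀ J K, Odd (List.length K) → ω 0 J K = 0) {f : ℕ → PowerSeries ℂ}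
    (hf : ∀ j, applyW (S.coordF j) S.omega00 = laurent (-1) (f j)) (a b : ℕ) :
    ∃ P, S.quadFF ω 0 [] [a, b] = laurent (-2) P ∧ PowerSeries.coeff 0 P = 0 ∧
      PowerSeries.coeff 1 P = 0 ∧ PowerSeries.coeff 2 P = 2 * minor f a b := by
  have h₀ : S.legF ω 0 [] [] = 0 := S.legF_eq_zero (by simp) fun j => hodd _ _ (by simp)
  have h₁ : ∀ j, S.legF ω 0 [] [j] = laurent (-1) (f j) := hf
  have h₂ : S.legF ω 0 [] [a, b] = 0 := S.legF_eq_zero (by simp) fun j => hodd _ _ (by simp; decide)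
  have key : S.quadFF ω 0 [] [a, b] = zz * (HahnSeries.C (1 / 2) *
      (dd (laurent (-1) (f a)) * reflect (laurent (-1) (f b)) -
        dd (laurent (-1) (f b)) * reflect (laurent (-1) (f a)) +
      (dd (reflect (laurent (-1) (f a))) * laurent (-1) (f b) -
        dd (reflect (laurent (-1) (f b))) * laurent (-1) (f a)))) := by
    rw [quadFF, sumSplits_zero_nil, sumSplits_zero_nil, ← half_laurentSeries]
    simp only [splits, List.flatMap_cons, List.flatMap_nil, List.append_nil, List.cons_append,
      List.nil_append, List.map_cons, List.map_nil, List.sum_cons, List.sum_nil, List.length_cons,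
      List.length_nil, h₀, h₁, h₂, sigmaF, reflect_zero, mul_zero, smul_zero]
    congr 1
    norm_num
    ring
  rw [key, zz_eq_laurent]
  simp only [reflect_laurent_neg_one, dd_laurent, laurent_mul, laurent_add, laurent_sub,
    C_mul_laurent]
  refine ⟨_, rfl, ?_⟩
  simp only [one_mul, PowerSeries.coeff_C_mul, map_sub, map_add]
  simp only [minor, coeff_zero_mul_eq, coeff_one_mul_eq, coeff_two_mul_eq, PowerSeries.coeff_mk,
    PowerSeries.coeff_rescale, map_neg]
  push_cast
  refine ⟨?_, ?_, ?_⟩ <;> ring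

theorem exists_bosonicRecursion_pair {f : ℕ → PowerSeries ℂ}
    (hf : ∀ j, applyW (S.coordF j) S.omega00 = laurent (-1) (f j)) :
    ∃ c : ℂ, ∀ ω : System, (∀ J K, Odd (List.length K) → ω 0 J K = 0) → ∀ i a b,
      S.bosonicRecursion ω 0 i [] [a, b] = if i = 1 then c * minor f a b else 0 := by
  obtain ⟨-, u, hu⟩ := S.exists_inv_kernelDenominator
  -- The product has order 1 - 2 - 2 = -3, so the residue is a coefficient of index 2. The two
  -- vanishing coefficients of P reduce it to leading terms, and the factor 2 comes from P.
  refine ⟨2 * PowerSeries.coeff 0 u, fun ω hodd i a b => ?_⟩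
  obtain ⟨P, hP, h0, h1, h2⟩ := S.quadFF_pair hodd hf a b
  obtain ⟨p, hp, hp0⟩ := S.applyW_coordB_kernelBB i
  rw [bosonicRecursion, S.quadBB_pair hodd, zero_add, hP, hp, hu, laurent_mul, laurent_mul]
  refine (res_laurent 2 _).trans ?_
  have : PowerSeries.coeff 2 (p * u * P) =
      PowerSeries.coeff 0 p * PowerSeries.coeff 0 u * PowerSeries.coeff 2 P := by
    simp [PowerSeries.coeff_mul, Finset.Nat.antidiagonal_succ, h0, h1]
  rw [this, hp0, h2]
  split_ifs <;> ring

/-! ### The correlators `ω_{0,0|4}` and `ω_{0,1|4}` -/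

theorem legB_pair {f : ℕ → PowerSeries ℂ} {c : ℂ} {a b : ℕ}
    (h : ∀ i, ω 0 [i] [a, b] = if i = 1 then c * minor f a b else 0) :
    S.legB ω 0 [] [a, b] = HahnSeries.C (c * minor f a b) * S.dxiNeg 1 := by
  have : S.legB ω 0 [] [a, b] = ∑ᶠ i : ℕ+, HahnSeries.C (ω 0 [i] [a, b]) * S.dxiNeg i := rfl
  rw [this, finsum_eq_single _ 1 fun i hi => by rw [h, if_neg hi, map_zero, zero_mul], h,
    if_pos rfl]

/-- The signed sum is proportional to M_ab M_de - M_ad M_be + M_ae M_bd, which vanishes by the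
Plücker relation. -/
theorem quadBB_quadruple (hodd : ∀ J K, Odd (List.length K) → ω 0 J K = 0)
    {f : ℕ → PowerSeries ℂ} {c : ℂ}
    (h : ∀ i a b, ω 0 [i] [a, b] = if i = 1 then c * minor f a b else 0) (a b d e : ℕ) :
    S.quadBB ω 0 [] [a, b, d, e] = 0 := by
  have h₀ : S.legB ω 0 [] [] = 0 := rfl
  rw [quadBB, sumSplits_zero_nil]
  simp only [splits, List.flatMap_cons, List.flatMap_nil, List.append_nil, List.cons_append,
    List.nil_append, List.map_cons, List.map_nil, List.sum_cons, List.sum_nil, List.length_cons,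
    List.length_nil, h₀, S.legB_singleton hodd, S.legB_pair fun i => h i _ _, sigmaB, reflect_C_mul,
    reflect_zero, mul_zero, zero_mul, neg_zero, zsmul_eq_mul]
  simp only [minor, map_mul, map_sub]
  push_cast
  ring

/-- Up to sign Q is x(z)g(-z) + x(-z)g(z), with g the combination of the f's below multiplied by c.
It is even, so the odd coefficients vanish. Those of index 0 and 2 involve only g₀ = 0, g₂ = 0 and
x₁g₁, where x₁ = 0. -/
theorem quadFB_triple (hodd : ∀ J K, Odd (List.length K) → ω 0 J K = 0)
    {f : ℕ → PowerSeries ℂ}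
    (hf : ∀ j, applyW (S.coordF j) S.omega00 = laurent (-1) (f j)) {c : ℂ}
    (h : ∀ i a b, ω 0 [i] [a, b] = if i = 1 then c * minor f a b else 0) (a b d : ℕ) :
    ∃ Q, S.quadFB ω 0 [] [a, b, d] = laurent (-3) Q ∧ ∀ k < 4, PowerSeries.coeff k Q = 0 := by
  have h₀ : S.legB ω 0 [] [] = 0 := rfl
  have h₁ : ∀ j, S.legF ω 0 [] [j] = laurent (-1) (f j) := hf
  have h₃ : S.legB ω 0 [] [a, b, d] = 0 := S.legB_eq_zero fun i => hodd _ _ (by simp; decide)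
  obtain ⟨x, hx, hx0, hx1⟩ := S.exists_dxiNeg_one
  have key : S.quadFB ω 0 [] [a, b, d] = laurent (-2) x * reflect (laurent (-1)
      (PowerSeries.C (c * minor f a b) * f d - PowerSeries.C (c * minor f a d) * f b +
        PowerSeries.C (c * minor f b d) * f a)) - reflect (laurent (-2) x) * (laurent (-1)
      (PowerSeries.C (c * minor f a b) * f d - PowerSeries.C (c * minor f a d) * f b +
        PowerSeries.C (c * minor f b d) * f a)) := by
    rw [quadFB, sumSplits_zero_nil, sumSplits_zero_nil]
    simp only [splits, List.flatMap_cons, List.flatMap_nil, List.append_nil, List.cons_append,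
      List.nil_append, List.map_cons, List.map_nil, List.sum_cons, List.sum_nil, List.length_cons,
      List.length_nil, h₀, h₁, h₃, S.legB_singleton hodd, S.legB_pair fun i => h i _ _, hx,
      sigmaB, sigmaF, reflect_zero, zero_mul, neg_zero,
      ← laurent_add, ← laurent_sub, ← C_mul_laurent, reflect_add, reflect_sub, reflect_C_mul,
      zsmul_eq_mul]
    push_cast
    ring
  rw [key]
  simp only [reflect_laurent_neg_one, reflect_laurent_neg_two, laurent_mul, laurent_sub]
  refine ⟨_, rfl, fun k hk => ?_⟩
  interval_cases k <;>
  · simp only [map_sub, map_add, map_neg, map_mul, mul_sub, mul_add, mul_neg]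
    simp only [minor, coeff_zero_mul_eq, coeff_one_mul_eq, coeff_two_mul_eq, coeff_three_mul_eq,
      PowerSeries.coeff_rescale, map_sub, PowerSeries.coeff_C, hx0, hx1]
    norm_num
    try ring

theorem omegaHat_eq_zero {g : ℕ} {J : List ℕ+} {j₂ : ℕ} {K : List ℕ} {Q : PowerSeries ℂ}
    (hQ : S.quadFB ω g J (j₂ :: K) = laurent (-3) Q) (h : ∀ k < 4, PowerSeries.coeff k Q = 0)
    (j₁ : ℕ) : S.omegaHat ω g J j₁ j₂ K = 0 := by
  obtain ⟨-, u, hu⟩ := S.exists_inv_kernelDenominator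
  obtain ⟨p, hp⟩ := S.applyW_coordF_kernelBF j₁
  rw [omegaHat, hQ, hp, hu, zz_eq_laurent, laurent_mul, laurent_mul, laurent_mul]
  -- The orders add up to 0 - 2 - 3 + 1 = -4, so only coefficients of Q of index at most 3
  -- contribute.
  refine (res_laurent 3 _).trans ?_
  simp [PowerSeries.coeff_mul, Finset.Nat.antidiagonal_succ, h]

theorem fermionicRecursion_eq_zero {g : ℕ} {J : List ℕ+} {K : List ℕ}
    (h : ∀ j₁ j₂, S.omegaHat ω g J j₁ j₂ K = 0) (j₁ j₂ : ℕ) :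
    S.fermionicRecursion ω g J j₁ j₂ K = 0 := by
  simp [fermionicRecursion, h]

/-! ### Longer lists of fermionic entries -/

/-- A nonzero bosonic factor must be ω_{0,1|2}. It then leaves at least three entries for the
fermionic factor, which is some ω_{0,0|2m} with m ≥ 2. -/
theorem quadFB_eq_zero {K : List ℕ} (hodd : ∀ J K, Odd (List.length K) → ω 0 J K = 0)
    (hK : Odd K.length) (h5 : 5 ≤ K.length)
    (h : ∀ J K', List.length J ≤ 1 → Even (List.length K') → 4 ≤ List.length K' →
      List.length J + List.length K' < K.length + 1 → ω 0 J K' = 0) :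
    S.quadFB ω 0 [] K = 0 := by
  have key : ∀ K₁ K₂ : List ℕ, K₁.length + K₂.length = K.length →
      S.legB ω 0 [] K₁ = 0 ∨ S.legF ω 0 [] K₂ = 0 := by
    intro K₁ K₂ hlen
    rcases Nat.even_or_odd K₁.length with he | ho
    · rcases lt_or_ge K₁.length 4 with h4 | h4
      · obtain ⟨r, hr⟩ := he
        rcases Nat.eq_zero_or_pos r with rfl | hr0
        · rw [List.length_eq_zero_iff.1 (by lia : K₁.length = 0)]
          exact Or.inl rfl
        · refine Or.inr (S.legF_eq_zero (by lia) fun j => h _ _ (by simp) ?_ ?_ ?_)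
          · rw [List.length_cons, Nat.even_add_one, Nat.not_even_iff_odd]
            grind
          all_goals simp only [List.length_cons, List.length_nil]; lia
      · refine Or.inl (S.legB_eq_zero fun i => h _ _ (by simp) he h4 ?_)
        have : K₁.length ≠ K.length := fun h' => by
          rw [h'] at he
          exact Nat.not_even_iff_odd.2 hK he
        simp only [List.length_cons, List.length_nil]
        lia
    · exact Or.inl (S.legB_eq_zero fun i => hodd _ _ ho)
  rw [quadFB, sumSplits_eq_zero, sumSplits_eq_zero, add_zero, add_zero]
  all_goals
    intro K₁ K₂ hlen
    rcases key K₁ K₂ hlen with h | h <;> simp [h, sigmaB, sigmaF, reflect_zero]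

/-- Both factors would have to be ω_{0,1|2}, which accounts for four entries only. -/
theorem quadBB_eq_zero {K : List ℕ} (hodd : ∀ J K, Odd (List.length K) → ω 0 J K = 0)
    (h6 : 6 ≤ K.length)
    (h : ∀ J K', List.length J ≤ 1 → Even (List.length K') → 4 ≤ List.length K' →
      List.length J + List.length K' < K.length + 1 → ω 0 J K' = 0) :
    S.quadBB ω 0 [] K = 0 := by
  have hB : ∀ K₁ : List ℕ, K₁.length < K.length → K₁.length ≠ 2 → S.legB ω 0 [] K₁ = 0 := by
    intro K₁ hlt h2
    rcases Nat.even_or_odd K₁.length with he | ho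
    · rcases lt_or_ge K₁.length 4 with h4 | h4
      · obtain ⟨r, hr⟩ := he
        rw [List.length_eq_zero_iff.1 (by lia : K₁.length = 0)]
        rfl
      · refine S.legB_eq_zero fun i => h _ _ (by simp) he h4 ?_
        simp only [List.length_cons, List.length_nil]
        lia
    · exact S.legB_eq_zero fun i => hodd _ _ ho
  rw [quadBB, sumSplits_eq_zero, add_zero]
  intro K₁ K₂ hlen
  have key : S.legB ω 0 [] K₁ = 0 ∨ S.legB ω 0 [] K₂ = 0 := by
    rcases Nat.eq_zero_or_pos K₁.length with h₁ | h₁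
    · rw [List.length_eq_zero_iff.1 h₁]
      exact Or.inl rfl
    rcases Nat.eq_zero_or_pos K₂.length with h₂ | h₂
    · rw [List.length_eq_zero_iff.1 h₂]
      exact Or.inr rfl
    by_cases h₃ : K₁.length = 2
    · exact Or.inr (hB _ (by lia) (by lia))
    · exact Or.inl (hB _ (by lia) h₃)
  rcases key with h | h <;> simp [h, sigmaB, reflect_zero]

/-- Both factors would have to be ω_{0,0|2}, which accounts for two entries only. -/
theorem quadFF_eq_zero {K : List ℕ} (hodd : ∀ J K, Odd (List.length K) → ω 0 J K = 0)
    (h4 : 4 ≤ K.length)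
    (h : ∀ J K', List.length J ≤ 1 → Even (List.length K') → 4 ≤ List.length K' →
      List.length J + List.length K' < K.length + 1 → ω 0 J K' = 0) :
    S.quadFF ω 0 [] K = 0 := by
  have hE : ∀ K₁ : List ℕ, Even K₁.length → S.legF ω 0 [] K₁ = 0 := by
    intro K₁ he
    refine S.legF_eq_zero (fun h => by simp [h] at he) fun j => hodd _ _ ?_
    rw [List.length_cons]
    exact he.add_one
  have hF : ∀ K₁ : List ℕ, K₁.length < K.length → K₁.length ≠ 1 → S.legF ω 0 [] K₁ = 0 := by
    intro K₁ hlt h1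
    rcases Nat.even_or_odd K₁.length with he | ho
    · exact hE K₁ he
    · refine S.legF_eq_zero h1 fun j => h _ _ (by simp) ?_ ?_ ?_
      · rw [List.length_cons]
        exact ho.add_one
      all_goals
        obtain ⟨r, hr⟩ := ho
        simp only [List.length_cons, List.length_nil]
        lia
  have key : ∀ K₁ K₂ : List ℕ, K₁.length + K₂.length = K.length →
      S.legF ω 0 [] K₁ = 0 ∨ S.legF ω 0 [] K₂ = 0 := by
    intro K₁ K₂ hlen
    rcases Nat.eq_zero_or_pos K₁.length with h₁ | h₁
    · exact Or.inl (hE _ (by simp [h₁]))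
    rcases Nat.eq_zero_or_pos K₂.length with h₂ | h₂
    · exact Or.inr (hE _ (by simp [h₂]))
    by_cases h₃ : K₁.length = 1
    · exact Or.inr (hF _ (by lia) (by lia))
    · exact Or.inl (hF _ (by lia) h₃)
  rw [quadFF, sumSplits_eq_zero, sumSplits_eq_zero]
  · simp
  all_goals
    intro K₁ K₂ hlen
    rcases key K₁ K₂ hlen with h | h <;> simp [h, sigmaF, reflect_zero, dd]

/-! ### Vanishing -/

/-- The system `ω` has no entries with an odd number of fermionic indices in genus zero, and its
entries with no (respectively one) bosonic index are computed by the fermionic (respectively bosonic)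
recursion from the entries with fewer indices. -/
structure GenusZeroRecursive (ω : System) : Prop where
  odd : ∀ J K, Odd (List.length K) → ω 0 J K = 0
  bosonic : ∀ i K, Even (List.length K) → 2 ≤ List.length K → ∃ ω' : System,
    (∀ J K', Odd (List.length K') → ω' 0 J K' = 0) ∧
    (∀ J K', List.length J + List.length K' < K.length + 1 → ω' 0 J K' = ω 0 J K') ∧
    ω 0 [i] K = S.bosonicRecursion ω' 0 i [] K
  fermionic : ∀ j₁ j₂ K, Even (List.length K) → 2 ≤ List.length K → ∃ ω' : System,
    (∀ J K', Odd (List.length K') → ω' 0 J K' = 0) ∧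
    (∀ J K', List.length J + List.length K' < K.length + 2 → ω' 0 J K' = ω 0 J K') ∧
    ω 0 [] (j₁ :: j₂ :: K) = S.fermionicRecursion ω' 0 [] j₁ j₂ K

theorem SatisfiesRecursion.genusZeroRecursive {S : LocalSuperSpectralCurve}
    (h : S.SatisfiesRecursion ω) : S.GenusZeroRecursive ω where
  odd := h.odd 0
  bosonic i K hK h2 := ⟨ω, h.odd 0, fun _ _ _ => rfl, h.bosonic 0 i [] K hK (by simp; lia)⟩
  fermionic j₁ j₂ K hK h2 :=
    ⟨ω, h.odd 0, fun _ _ _ => rfl, h.fermionic 0 [] j₁ j₂ K hK (by simp; lia)⟩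

theorem correlator_odd (g : ℕ) (J : List ℕ+) (K : List ℕ) (hK : Odd K.length) :
    S.correlator g J K = 0 := by
  rw [correlator, step.eq_def, if_neg fun h => Nat.not_even_iff_odd.2 hK h.2]

theorem genusZeroRecursive_correlator : S.GenusZeroRecursive S.correlator where
  odd := S.correlator_odd 0
  bosonic i K hK h2 := by
    -- The truncated system to which `correlator` applies `step`; it agrees with `correlator` on all
    -- smaller entries, which is why ω' is allowed to differ from ω.
    refine ⟨fun g' J' K' => if 2 * g' + J'.length + K'.length < 2 * 0 + [i].length + K.length then
      S.correlator g' J' K' else 0, fun J K' h => ?_, fun J K' h => ?_, ?_⟩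
    · simp [S.correlator_odd 0 J K' h]
    · exact if_pos (by simp; lia)
    · rw [correlator, step, if_pos ⟨by simp; lia, hK⟩]
      simp only [dite_eq_ite]
  fermionic j₁ j₂ K hK h2 := by
    refine ⟨fun g' J' K' => if 2 * g' + J'.length + K'.length <
      2 * 0 + ([] : List ℕ+).length + (j₁ :: j₂ :: K).length then
      S.correlator g' J' K' else 0, fun J K' h => ?_, fun J K' h => ?_, ?_⟩
    · simp [S.correlator_odd 0 J K' h]
    · exact if_pos (by simp; lia)
    · rw [correlator, step, if_pos ⟨by simp; lia, by simpa [Nat.even_add_one] using hK⟩]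
      simp only [dite_eq_ite]

/-- Induction on |J| + |K| places ω_{0,0|2m} before ω_{0,1|2m}, and the latter before ω_{0,0|2m+2}.
-/
theorem GenusZeroRecursive.eq_zero {S : LocalSuperSpectralCurve} (h : S.GenusZeroRecursive ω)
    (J : List ℕ+) (K : List ℕ) (hJ : J.length ≤ 1) (hK : Even K.length) (h4 : 4 ≤ K.length) :
    ω 0 J K = 0 := by
  choose f hf using S.exists_applyW_omega00
  obtain ⟨c, hc⟩ := S.exists_bosonicRecursion_pair hf
  -- For two fermionic entries the recursion reads only curve data, so the same f and c serve for ω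
  -- and for every auxiliary ω'.
  have hpair : ∀ i a b, ω 0 [i] [a, b] = if i = 1 then c * minor f a b else 0 := by
    intro i a b
    obtain ⟨ω', hodd, -, hω'⟩ := h.bosonic i [a, b] (by simp) (by simp)
    rw [hω', hc ω' hodd]
  obtain ⟨n, hn⟩ : ∃ n, J.length + K.length = n := ⟨_, rfl⟩
  induction n using Nat.strong_induction_on generalizing J K with
  | _ n ih =>
  subst hn
  match J, hJ with
  | [], _ =>
    match K, hK, h4 with
    | j₁ :: j₂ :: K, hK, h4 =>
    have hK' : Even K.length := by simpa [Nat.even_add_one] using hK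
    have hlen : 2 ≤ K.length := by simpa using h4
    obtain ⟨ω', hodd, hagree, hω'⟩ := h.fermionic j₁ j₂ K hK' hlen
    rw [hω']
    refine S.fermionicRecursion_eq_zero (fun j₁ j₂ => ?_) _ _
    match K, hK', hlen with
    | [a, b], _, _ =>
      obtain ⟨Q, hQ, hQ0⟩ := S.quadFB_triple hodd hf (c := c)
        (fun i a b => by rw [hagree _ _ (by simp), hpair]) j₂ a b
      exact S.omegaHat_eq_zero hQ hQ0 j₁
    | a :: b :: d :: K, hK', _ =>
      -- By parity a fourth entry follows a, b, d, so together with j₂ there are the five that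
      -- `quadFB_eq_zero` requires.
      have hpos : 1 ≤ K.length := by
        by_contra h0
        rw [List.length_eq_zero_iff.1 (by lia : K.length = 0)] at hK'
        exact absurd hK' (by simp; decide)
      rw [omegaHat, S.quadFB_eq_zero hodd, mul_zero, zero_mul, res, HahnSeries.coeff_zero]
      · rw [List.length_cons]
        exact hK'.add_one
      · simp only [List.length_cons]
        lia
      · intro J K' hJ hK h4 hlt
        simp only [List.length_cons] at hlt
        rw [hagree _ _ (by simp only [List.length_cons]; lia)]
        exact ih _ (by simp only [List.length_cons, List.length_nil]; lia) J K' hJ hK h4 rfl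
  | [i], _ =>
    obtain ⟨ω', hodd, hagree, hω'⟩ := h.bosonic i K hK (by lia)
    have hvan : ∀ J K', List.length J ≤ 1 → Even (List.length K') → 4 ≤ List.length K' →
        List.length J + List.length K' < K.length + 1 → ω' 0 J K' = 0 := by
      intro J K' hJ hK h4 hlt
      rw [hagree _ _ hlt]
      exact ih _ (by simp only [List.length_cons, List.length_nil]; lia) J K' hJ hK h4 rfl
    have hBB : S.quadBB ω' 0 [] K = 0 := by
      -- Products of two ω_{0,1|2} occur only for exactly four entries; this is the Plücker case.
      rcases lt_or_ge K.length 6 with h6 | h6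
      · have h4' : K.length = 4 := by
          obtain ⟨r, hr⟩ := hK
          lia
        obtain ⟨a, b, d, e, rfl⟩ := List.length_eq_four.1 h4'
        exact S.quadBB_quadruple hodd (c := c)
          (fun i a b => by rw [hagree _ _ (by simp), hpair]) a b d e
      · exact S.quadBB_eq_zero hodd h6 hvan
    rw [hω', bosonicRecursion, hBB, S.quadFF_eq_zero hodd h4 hvan, add_zero, mul_zero, res,
      HahnSeries.coeff_zero]

end LocalSuperSpectralCurve

end

end SuperTR

/-- On every local super spectral curve, `ω_{0,0|2m} = 0` and `ω_{0,1|2m} = 0` for all `m ≥ 2`: for the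
correlators built by super topological recursion, and for every system of differentials that satisfies
both recursion formulae. -/
theorem proposition5p6 (S : SuperTR.LocalSuperSpectralCurve) :
    (∀ m : ℕ, 2 ≤ m →
      SuperTR.System.VanishesAt S.correlator 0 0 (2 * m) ∧
      SuperTR.System.VanishesAt S.correlator 0 1 (2 * m)) ∧
    (∀ ω : SuperTR.System, S.SatisfiesRecursion ω → ∀ m : ℕ, 2 ≤ m →
      ω.VanishesAt 0 0 (2 * m) ∧ ω.VanishesAt 0 1 (2 * m)) := by
  have key : ∀ ω : SuperTR.System, S.GenusZeroRecursive ω → ∀ m : ℕ, 2 ≤ m →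
      ω.VanishesAt 0 0 (2 * m) ∧ ω.VanishesAt 0 1 (2 * m) := fun ω h m hm =>
    ⟨fun J K hJ hK => h.eq_zero J K (by lia) (by simp [hK]) (by lia),
      fun J K hJ hK => h.eq_zero J K (by lia) (by simp [hK]) (by lia)⟩
  exact ⟨key _ S.genusZeroRecursive_correlator, fun ω h => key ω h.genusZeroRecursive⟩
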